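/- **Setup.** Let $X_1,X_2,\dots$ be a process on a probability space $(\Omega,\mathcal F,P)$ with values in a measurable space, $\mathbf X_n=(X_1,\dots,X_n)$. The data are modelled by process laws $F_\theta$, $\theta\in\Theta$, where $\Theta=\prod_k\Theta_k$ (finitely or infinitely many factors) carries a $\sigma$-algebra $\mathcal T$ and a prior probability measure $\pi$; $P$ need not be among the $F_\theta$. For each $n$ the law of $\mathbf X_n$ under $P$ and the laws under all $F_\theta$ have densities $p$, $f_\theta$ with respect to a common reference measure. Put $R_n(\theta)=f_\theta(\mathbf X_n)/p(\mathbf X_n)$, $h(\theta)=\lim_n \frac1n E_P\log\frac{p(\mathbf X_n)}{f_\theta(\mathbf X_n)}\in[0,\infty]$, $h(A)=\operatorname{ess\,inf}_{\theta\in A}h(\theta)$ (with respect to $\pi$), $J(\theta)=h(\theta)-h(\Theta)$, $J(A)=\operatorname{ess\,inf}_{\theta\in A}J(\theta)$, $I=\{\theta: h(\theta)=\infty\}$, and $\pi(A\mid\mathbf X_n)=\int_A f_\theta(\mathbf X_n)\,d\pi\big/\int_\Theta f_\theta(\mathbf X_n)\,d\pi$. Assume: * (S1) $R_n(\theta)$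 is $\sigma(\mathbf X_n)\times\mathcal T$-measurable for every $n$. * (S2) For each $\theta$, $\frac1n\log R_n(\theta)\to-h(\theta)$ $P$-almost surely. * (S3) For each $\theta$ the limit $h(\theta)$ exists in $[0,\infty]$, and $h$ is $\mathcal T$-measurable. * (S4) $\pi(I)<1$. * (S5) There are $\mathcal G_n\in\mathcal T$ with $\mathcal G_n\to\Theta$ (each $\theta$ lies in $\mathcal G_n$ for all large $n$) such that (1) $\pi(\mathcal G_n)\ge1-\alpha e^{-\varsigma n}$ for all $n \geq 1$, for some $\alpha>0$, $\varsigma>2h(\Theta)$; (2) almost surely, $\sup_{\theta\in\mathcal G_n\setminus I}\left|\frac1n\log R_n(\theta)+h(\theta)\right|\to0$ and $\operatorname{ess\,sup}_{\theta\in\mathcal G_n\cap I}\frac1n\log R_n(\theta)\to-\infty$ (the second requirement is empty if $\pi(I)=0$); (3) $h(\mathcal G_n)\to h(\Theta)$. * (S6) For $A\in\mathcal T$, $\delta>0$ let $\tau(A,\delta)$ be the least natural number such that $\frac1k\log\int_A R_k\,d\pi\le\delta+\limsup_{l}\frac1l\log\int_A R_l\,d\pi$ for all $k>\tau(A,\delta)$,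 provided the $\limsup$ is $<\infty$. For every $\delta>0$, almost surely, $n>\tau(\mathcal G_n,\delta)$ for all sufficiently large $n$. * (S7) $h(\mathcal G_n\cap A)\to h(A)$ for every $A\in\mathcal T$ with $\pi(A)>0$. **Tests.** Let $m$ be finite. For $i=1,\dots,m$ test $H_{0i}:\theta_i\in\Theta_{0i}$ against $H_{1i}:\theta_i\in\Theta_{1i}=\Theta_i\setminus\Theta_{0i}$, with $\{\theta:\theta_i\in\Theta_{0i}\}\in\mathcal T$ and arbitrary groups $G_i\subseteq\{1,\dots,m\}$, $i\in G_i$. For $d\in\{0,1\}^m$ ($d_i=1$: $H_{0i}$ is rejected) let $\Theta(d)=\{\theta:\theta_i\in\Theta_{d_ii},\ i=1,\dots,m\}$, and assume that there is exactly one configuration $d=d^t$, the true one, with $J(\Theta(d^t))=J(\Theta)$. Put $$v_{in}=\pi(H_{1i}\mid\mathbf X_n),\qquad w_{in}(d)=\pi\Big(H_{1i}\cap\bigcap_{j\in G_i,\,j\ne i}H_{d_jj}\ \Big|\ \mathbf X_n\Big).$$ Given $\beta_n\in(0,1)$, the non-marginal procedure chooses, as a measurable function of $\mathbf X_n$, a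 maximizer $\hat d_n$ of $\sum_{i=1}^m d_i(w_{in}(d)-\beta_n)$ over $d\in\{0,1\}^m$ (ties may be broken in any measurable way). Define $$pBFDR_n=E_P\left[\frac{\sum_i d_i(1-v_{in})}{\left(\sum_i d_i\right)\vee1}\Big|_{d=\hat d_n}\ \Big|\ \hat d_n\neq\mathbf 0\right],\qquad mpBFDR_n=E_P\left[\frac{\sum_i d_i(1-w_{in}(d))}{\left(\sum_i d_i\right)\vee1}\Big|_{d=\hat d_n}\ \Big|\ \hat d_n\ne\mathbf 0\right].$$ **Theorem.** Assume in addition * (A1) $\liminf_n\beta_n>0$ and $\limsup_n\beta_n<1$; * (A2) $d^t\neq\mathbf 0$ and $d^t\ne\mathbf 1$. Then $P(\hat d_n\ne\mathbf 0)>0$ for all sufficiently large $n$, so that the two conditional expectations are defined, and $$\lim_{n\to\infty}mpBFDR_n=0,\qquad \lim_{n\to\infty}pBFDR_n=0.$$ -/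

import Mathlib

open MeasureTheory ProbabilityTheory Filter Topology
open scoped ENNReal NNReal

noncomputable section

/-- The true process `X₁, X₂, …` (here `X 0, X 1, …`) on a probability space `(Ω, P)` with values in `Ξ`,
a postulated family of process laws `F θ`, `θ ∈ T`, and a prior on `T`. The law of `(X₁, …, Xₙ)` under
`P` and under every `F θ` has a density (`p n`, respectively `f n θ`) with respect to a common
reference measure `ν n`. The true law need not belong to the family. -/
structure BayesModel (Ω Ξ T : Type*) [MeasurableSpace Ω] [MeasurableSpace Ξ]
    [MeasurableSpace T] where
  P : Measure Ω
  isProb_P : IsProbabilityMeasure P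
  X : ℕ → Ω → Ξ
  measurable_X : ∀ t, Measurable (X t)
  F : T → Measure (ℕ → Ξ)
  isProb_F : ∀ θ, IsProbabilityMeasure (F θ)
  ν : (n : ℕ) → Measure (Fin n → Ξ)
  p : (n : ℕ) → (Fin n → Ξ) → ℝ≥0
  measurable_p : ∀ n, Measurable (p n)
  law_p : ∀ n, P.map (fun ω (t : Fin n) => X t ω) = (ν n).withDensity (fun x => (p n x : ℝ≥0∞))
  f : (n : ℕ) → T → (Fin n → Ξ) → ℝ≥0
  measurable_f : ∀ n θ, Measurable (f n θ)
  law_f : ∀ n θ, (F θ).map (fun (x : ℕ → Ξ) (t : Fin n) => x t)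
    = (ν n).withDensity (fun x => (f n θ x : ℝ≥0∞))
  prior : Measure T
  isProb_prior : IsProbabilityMeasure prior

namespace BayesModel

variable {Ω Ξ T : Type*} [MeasurableSpace Ω] [MeasurableSpace Ξ] [MeasurableSpace T]

/-- The data vector `𝐗ₙ = (X₁, …, Xₙ)`. -/
def data (M : BayesModel Ω Ξ T) (n : ℕ) (ω : Ω) : Fin n → Ξ := fun t => M.X t ω

/-- The likelihood ratio `Rₙ(θ) = f_θ(𝐗ₙ) / p(𝐗ₙ)` (the denominator vanishes with `P`-probability 0). -/
def R (M : BayesModel Ω Ξ T) (n : ℕ) (θ : T) (ω : Ω) : ℝ≥0 :=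
  M.f n θ (M.data n ω) / M.p n (M.data n ω)

/-- `n⁻¹ log Rₙ(θ)`, with `log 0 = -∞`. -/
def logR (M : BayesModel Ω Ξ T) (n : ℕ) (θ : T) (ω : Ω) : EReal :=
  ENNReal.log (M.R n θ ω : ℝ≥0∞) / (n : EReal)

/-- `n⁻¹ log ∫_A Rₙ dπ`. -/
def logIntR (M : BayesModel Ω Ξ T) (A : Set T) (n : ℕ) (ω : Ω) : EReal :=
  ENNReal.log (∫⁻ θ in A, (M.R n θ ω : ℝ≥0∞) ∂M.prior) / (n : EReal)

/-- `n⁻¹ E log (p(𝐗ₙ) / f_θ(𝐗ₙ))`: the normalized Kullback-Leibler divergence of the law of the data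
under `F θ` from their true law. -/
def klPerObs (M : BayesModel Ω Ξ T) (n : ℕ) (θ : T) : ℝ≥0∞ :=
  InformationTheory.klDiv (M.P.map (M.data n))
    ((M.F θ).map (fun (x : ℕ → Ξ) (t : Fin n) => x t)) / (n : ℝ≥0∞)

/-- The KL-divergence rate `h(θ)`; that the upper limit is a limit is a condition below. -/
def h (M : BayesModel Ω Ξ T) (θ : T) : ℝ≥0∞ := limsup (fun n => M.klPerObs n θ) atTop

/-- `h(A) = ess inf_{θ ∈ A} h(θ)` with respect to the prior (`∞` if `A` is a null set). -/
def hSet (M : BayesModel Ω Ξ T) (A : Set T) : ℝ≥0∞ := essInf M.h (M.prior.restrict A)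

/-- `J(θ) = h(θ) - h(Θ)`. As `h(θ) ≥ h(Θ)` for almost all `θ`, truncating the difference at `0`
changes `J` on a null set only. -/
def J (M : BayesModel Ω Ξ T) (θ : T) : ℝ≥0∞ := M.h θ - M.hSet Set.univ

/-- `J(A) = ess inf_{θ ∈ A} J(θ)` with respect to the prior. -/
def JSet (M : BayesModel Ω Ξ T) (A : Set T) : ℝ≥0∞ := essInf M.J (M.prior.restrict A)

/-- `I = {θ : h(θ) = ∞}`. -/
def infSet (M : BayesModel Ω Ξ T) : Set T := {θ | M.h θ = ∞}

/-- `n > τ(A, δ)`, where `τ(A, δ)` is the least natural number such that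
`k⁻¹ log ∫_A R_k dπ ≤ δ + limsup_k k⁻¹ log ∫_A R_k dπ` for all `k > τ(A, δ)`,
provided that the upper limit is less than `∞`. -/
def BeyondTau (M : BayesModel Ω Ξ T) (A : Set T) (δ : ℝ) (ω : Ω) (n : ℕ) : Prop :=
  limsup (fun k => M.logIntR A k ω) atTop < ⊤ →
    ∀ k ≥ n, M.logIntR A k ω ≤ (δ : EReal) + limsup (fun k => M.logIntR A k ω) atTop

/-- The conditions on the sieve `𝒢ₙ` for posterior convergence. -/
structure IsSieve (M : BayesModel Ω Ξ T) (G : ℕ → Set T) : Prop where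
  measurable : ∀ n, MeasurableSet (G n)
  tendsto_univ : ∀ θ, ∀ᶠ n in atTop, θ ∈ G n
  s5_prior : ∃ α : ℝ, 0 < α ∧ ∃ ς : ℝ, 2 * M.hSet Set.univ < ENNReal.ofReal ς ∧
    ∀ n : ℕ, 1 ≤ n → 1 - α * Real.exp (-ς * n) ≤ (M.prior (G n)).toReal
  /-- `n⁻¹ log Rₙ(θ) → -h(θ)` uniformly over `θ ∈ 𝒢ₙ \ I`, almost surely. -/
  s5_uniform : ∀ᵐ ω ∂M.P, ∀ ε : ℝ, 0 < ε → ∀ᶠ n in atTop, ∀ θ ∈ G n \ M.infSet,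
    -(M.h θ : EReal) - (ε : EReal) ≤ M.logR n θ ω ∧
      M.logR n θ ω ≤ -(M.h θ : EReal) + (ε : EReal)
  /-- The same over `𝒢ₙ ∩ I`, where the limit is `-∞`, up to sets of prior probability zero
  (an empty requirement if the prior probability of `I` is zero). -/
  s5_uniform_inf : ∀ᵐ ω ∂M.P, ∀ K : ℝ, ∀ᶠ n in atTop,
    ∀ᵐ θ ∂M.prior, θ ∈ G n ∩ M.infSet → M.logR n θ ω ≤ (-K : ℝ)
  s5_hSet : Tendsto (fun n => M.hSet (G n)) atTop (𝓝 (M.hSet Set.univ))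
  s6 : ∀ δ : ℝ, 0 < δ → ∀ᵐ ω ∂M.P, ∀ᶠ n in atTop, M.BeyondTau (G n) δ ω n
  s7 : ∀ A : Set T, MeasurableSet A → 0 < M.prior A →
    Tendsto (fun n => M.hSet (G n ∩ A)) atTop (𝓝 (M.hSet A))

/-- The conditions on the model and the prior for posterior convergence. -/
structure ShaliziConditions (M : BayesModel Ω Ξ T) : Prop where
  /-- `Rₙ` is measurable for the product of `σ(𝐗ₙ)` and the σ-algebra of the parameter space. -/
  s1 : ∀ n, Measurable[(MeasurableSpace.comap (M.data n) inferInstance).prod inferInstance]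
    (fun q : Ω × T => M.R n q.2 q.1)
  s2 : ∀ θ, ∀ᵐ ω ∂M.P, Tendsto (fun n => M.logR n θ ω) atTop (𝓝 (-(M.h θ : EReal)))
  s3_limit : ∀ θ, Tendsto (fun n => M.klPerObs n θ) atTop (𝓝 (M.h θ))
  s3_measurable : Measurable M.h
  s4 : M.prior M.infSet < 1
  sieve : ∃ G : ℕ → Set T, M.IsSieve G

/-- The posterior probability of `A` given the data `x ∈ Ξⁿ`, by Bayes' formula. -/
def posterior (M : BayesModel Ω Ξ T) (n : ℕ) (x : Fin n → Ξ) (A : Set T) : ℝ :=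
  ((∫⁻ θ in A, (M.f n θ x : ℝ≥0∞) ∂M.prior) / ∫⁻ θ, (M.f n θ x : ℝ≥0∞) ∂M.prior).toReal

end BayesModel

/-- Decision configurations: `d i = true` if the `i`-th null hypothesis is rejected. -/
abbrev Config (m : ℕ) := Fin m → Bool

/-- The number `1` or `0` that a decision stands for. -/
def ind (b : Bool) : ℝ := if b then 1 else 0

/-- `m` testing problems `H₀ᵢ : θ_{c i} ∈ Θ₀ᵢ` versus `H₁ᵢ : θ_{c i} ∈ Θ₁ᵢ = Θ_{c i} \ Θ₀ᵢ` about `m` different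
coordinates `c 1, …, c m` of the parameter `θ = (θ_k)_{k ∈ ι}`, with groups `Gᵢ ∋ i`. There may be
further, even infinitely many, coordinates. -/
structure TestingProblem (m : ℕ) {ι : Type*} (Θ : ι → Type*) [MeasurableSpace ((k : ι) → Θ k)] where
  c : Fin m ↪ ι
  null : (i : Fin m) → Set (Θ (c i))
  measurable_null : ∀ i, MeasurableSet {θ : (k : ι) → Θ k | θ (c i) ∈ null i}
  group : Fin m → Finset (Fin m)
  self_mem_group : ∀ i, i ∈ group i

namespace TestingProblem

variable {m : ℕ} {ι Ω Ξ : Type*} {Θ : ι → Type*} [MeasurableSpace ((k : ι) → Θ k)]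
  [MeasurableSpace Ω] [MeasurableSpace Ξ]

/-- The set of all parameters for which `H_{b i}` is true (`b = true` stands for the alternative). -/
def hyp (Q : TestingProblem m Θ) (b : Bool) (i : Fin m) : Set ((k : ι) → Θ k) :=
  {θ | if b then θ (Q.c i) ∉ Q.null i else θ (Q.c i) ∈ Q.null i}

/-- The part `Θ(d)` of the parameter space where all the decisions in `d` are correct. -/
def cell (Q : TestingProblem m Θ) (d : Config m) : Set ((k : ι) → Θ k) :=
  {θ | ∀ i, θ ∈ Q.hyp (d i) i}

/-- `d` is the true decision configuration: the only one with `J(Θ(d)) = J(Θ)`. -/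
def IsTrueConfig (Q : TestingProblem m Θ) (M : BayesModel Ω Ξ ((k : ι) → Θ k)) (dt : Config m) :
    Prop :=
  ∀ d, M.JSet (Q.cell d) = M.JSet Set.univ ↔ d = dt

/-- `v_{in}`, the posterior probability of `H₁ᵢ`. -/
def v (Q : TestingProblem m Θ) (M : BayesModel Ω Ξ ((k : ι) → Θ k)) (n : ℕ) (x : Fin n → Ξ)
    (i : Fin m) : ℝ :=
  M.posterior n x (Q.hyp true i)

/-- `w_{in}(d)`, the posterior probability that `H₁ᵢ` is true and that `H_{d_j j}` is true for all
`j ∈ Gᵢ`, `j ≠ i`. -/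
def w (Q : TestingProblem m Θ) (M : BayesModel Ω Ξ ((k : ι) → Θ k)) (n : ℕ) (x : Fin n → Ξ)
    (d : Config m) (i : Fin m) : ℝ :=
  M.posterior n x {θ | θ ∈ Q.hyp true i ∧ ∀ j ∈ Q.group i, j ≠ i → θ ∈ Q.hyp (d j) j}

/-- The objective function `∑ᵢ dᵢ (w_{in}(d) - β)`. -/
def objective (Q : TestingProblem m Θ) (M : BayesModel Ω Ξ ((k : ι) → Θ k)) (β : ℝ) (n : ℕ)
    (x : Fin n → Ξ) (d : Config m) : ℝ :=
  ∑ i, ind (d i) * (Q.w M n x d i - β)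

/-- `D` is a version of the non-marginal procedure with penalties `β n`: a measurable function of the
data that (almost surely) maximizes the objective function over all decision configurations. Ties
may be broken in any measurable way. -/
def IsNonMarginal (Q : TestingProblem m Θ) (M : BayesModel Ω Ξ ((k : ι) → Θ k)) (β : ℕ → ℝ)
    (D : (n : ℕ) → (Fin n → Ξ) → Config m) : Prop :=
  ∀ n, Measurable (D n) ∧ ∀ᵐ ω ∂M.P, ∀ d : Config m,
    Q.objective M (β n) n (M.data n ω) d ≤ Q.objective M (β n) n (M.data n ω) (D n (M.data n ω))

end TestingProblem

/-- `δ(d | x)`: the probability (`0` or `1`) that the rule `D` chooses `d` given the data `x`. -/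
def choiceProb {m n : ℕ} {Ξ : Type*} (D : (Fin n → Ξ) → Config m) (d : Config m)
    (x : Fin n → Ξ) : ℝ :=
  if D x = d then 1 else 0

namespace TestingProblem

variable {m : ℕ} {ι Ω Ξ : Type*} {Θ : ι → Type*} [MeasurableSpace ((k : ι) → Θ k)]
  [MeasurableSpace Ω] [MeasurableSpace Ξ]

/-- The posterior FDR of the rule `D` given the data `x`. -/
def posteriorFDR (Q : TestingProblem m Θ) (M : BayesModel Ω Ξ ((k : ι) → Θ k)) {n : ℕ}
    (D : (Fin n → Ξ) → Config m) (x : Fin n → Ξ) : ℝ :=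
  ∑ d : Config m,
    (∑ i, ind (d i) * (1 - Q.v M n x i)) / max (∑ i, ind (d i)) 1 * choiceProb D d x

/-- The modified posterior FDR of the rule `D` given the data `x`. -/
def modifiedPosteriorFDR (Q : TestingProblem m Θ) (M : BayesModel Ω Ξ ((k : ι) → Θ k)) {n : ℕ}
    (D : (Fin n → Ξ) → Config m) (x : Fin n → Ξ) : ℝ :=
  ∑ d : Config m,
    (∑ i, ind (d i) * (1 - Q.w M n x d i)) / max (∑ i, ind (d i)) 1 * choiceProb D d x

end TestingProblem

namespace BayesModel

variable {m : ℕ} {Ω Ξ T : Type*} [MeasurableSpace Ω] [MeasurableSpace Ξ] [MeasurableSpace T]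

/-- The event `δ(𝟎 | 𝐗ₙ) = 0` that `D` rejects at least one null hypothesis. -/
def someRejection (M : BayesModel Ω Ξ T) {n : ℕ} (D : (Fin n → Ξ) → Config m) : Set Ω :=
  {ω | choiceProb D (fun _ => false) (M.data n ω) = 0}

end BayesModel

namespace TestingProblem

variable {m : ℕ} {ι Ω Ξ : Type*} {Θ : ι → Type*} [MeasurableSpace ((k : ι) → Θ k)]
  [MeasurableSpace Ω] [MeasurableSpace Ξ]

/-- `pBFDR`: the conditional expectation under the true law of the data of the posterior FDR, given
that at least one null hypothesis is rejected. -/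
def pBFDR (Q : TestingProblem m Θ) (M : BayesModel Ω Ξ ((k : ι) → Θ k)) {n : ℕ}
    (D : (Fin n → Ξ) → Config m) : ℝ :=
  ∫ ω, Q.posteriorFDR M D (M.data n ω) ∂(ProbabilityTheory.cond M.P (M.someRejection D))

/-- `mpBFDR`: the same for the modified posterior FDR. -/
def mpBFDR (Q : TestingProblem m Θ) (M : BayesModel Ω Ξ ((k : ι) → Θ k)) {n : ℕ}
    (D : (Fin n → Ξ) → Config m) : ℝ :=
  ∫ ω, Q.modifiedPosteriorFDR M D (M.data n ω) ∂(ProbabilityTheory.cond M.P (M.someRejection D))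

end TestingProblem

end

/-!
The posterior concentrates on the true cell `Θ(dᵗ)`, the non-marginal procedure therefore eventually
chooses `dᵗ`, and both false discovery rates vanish in the limit by dominated convergence.

Concentration is a comparison of exponential rates for `∫ Rₙ dπ`. Over the whole parameter space the
integral is, up to a constant, at least `exp (-n (h(Θ) + ε))`, because the parameters in the sieve with
`h(θ)` close to `h(Θ)` keep a positive prior mass (`BayesModel.IsSieve.exists_le_lintegral`). Now let
`A` be a set with `h ≥ h(Θ) + e` almost everywhere. Within the sieve, uniform convergence of
`n⁻¹ log Rₙ` bounds the integral over `A` by `exp (-n (h(Θ) + e / 2))`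
(`BayesModel.IsSieve.eventually_lintegral_inter_le`). Outside the sieve, `E Rₙ(θ) ≤ 1` and the prior
bound show that the sum over `n` of `exp (n s) ∫ Rₙ dπ` has finite expectation for each `s < ς`; as
`ς > 2 h(Θ) ≥ h(Θ)`, an `s > h(Θ)` is possible (`BayesModel.IsSieve.tendsto_lintegral_compl`). So the
posterior probability of `A` tends to zero almost surely
(`BayesModel.ShaliziConditions.tendsto_posterior`).

The complement of `Θ(dᵗ)` is a finite union of cells with `J(Θ(d)) > 0`, so it is a set of this kind.
Hence all `w_{in}(dᵗ)` and `v_{in}` with `dᵗᵢ = 1` tend to one, while `w_{in}(d)` tends to zero for all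
`d` if `dᵗᵢ = 0`. As `β n` stays away from `0` and `1`, each wrong decision lowers the objective function
by an amount bounded away from zero, and `dᵗ` is eventually its only maximizer
(`TestingProblem.IsNonMarginal.eventually_eq`). Since `dᵗ ≠ 𝟎`, the probability of the conditioning
event tends to one, and on it the two posterior rates are eventually at most the posterior probability
of the complement of `Θ(dᵗ)`.
-/

namespace BayesModel

variable {Ω Ξ T : Type*} [MeasurableSpace Ω] [MeasurableSpace Ξ] [MeasurableSpace T]

/-! ### Likelihood ratios and densities -/

lemma logR_le_coe_iff (M : BayesModel Ω Ξ T) {n : ℕ} (hn : 0 < n) (θ : T) (ω : Ω) (y : ℝ) :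
    M.logR n θ ω ≤ (y : EReal) ↔
      (M.R n θ ω : ℝ≥0∞) ≤ ENNReal.ofReal (Real.exp (n * y)) := by
  have hn' : (0 : EReal) < (n : EReal) := by exact_mod_cast hn
  have hcast : (n : EReal) * (y : EReal) = ((n * y : ℝ) : EReal) := by
    rw [EReal.coe_mul]; rfl
  rw [logR, EReal.div_le_iff_le_mul hn' (EReal.natCast_ne_top n), hcast, ← EReal.exp_coe,
    ← EReal.exp_le_exp_iff, ENNReal.exp_log]

lemma coe_le_logR_iff (M : BayesModel Ω Ξ T) {n : ℕ} (hn : 0 < n) (θ : T) (ω : Ω) (y : ℝ) :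
    (y : EReal) ≤ M.logR n θ ω ↔
      ENNReal.ofReal (Real.exp (n * y)) ≤ (M.R n θ ω : ℝ≥0∞) := by
  have hn' : (0 : EReal) < (n : EReal) := by exact_mod_cast hn
  have hcast : (y : EReal) * (n : EReal) = ((n * y : ℝ) : EReal) := by
    rw [mul_comm, EReal.coe_mul]; rfl
  rw [logR, EReal.le_div_iff_mul_le hn' (EReal.natCast_ne_top n), hcast, ← EReal.exp_coe,
    ← EReal.exp_le_exp_iff (b := ENNReal.log _), ENNReal.exp_log]

lemma measurable_data (M : BayesModel Ω Ξ T) (n : ℕ) : Measurable (M.data n) :=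
  measurable_pi_lambda _ fun t => M.measurable_X t

lemma map_data (M : BayesModel Ω Ξ T) (n : ℕ) :
    M.P.map (M.data n) = (M.ν n).withDensity (fun x => (M.p n x : ℝ≥0∞)) := M.law_p n

lemma ae_p_ne_zero (M : BayesModel Ω Ξ T) (n : ℕ) : ∀ᵐ ω ∂M.P, M.p n (M.data n ω) ≠ 0 := by
  have hm : MeasurableSet {x | M.p n x ≠ 0} :=
    (M.measurable_p n (measurableSet_singleton 0)).compl
  refine (ae_map_iff (M.measurable_data n).aemeasurable hm).1 ?_
  rw [map_data, ae_withDensity_iff (M.measurable_p n).coe_nnreal_ennreal]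
  filter_upwards with x hx
  exact_mod_cast hx

/-- The expected likelihood ratio is at most one: it is the mass which the law of the data under
`F θ` gives to the set where the true density is positive. -/
lemma lintegral_R_le_one (M : BayesModel Ω Ξ T) (n : ℕ) (θ : T) :
    ∫⁻ ω, (M.R n θ ω : ℝ≥0∞) ∂M.P ≤ 1 := by
  have hg : Measurable fun x : Fin n → Ξ => ((M.f n θ x / M.p n x : ℝ≥0) : ℝ≥0∞) :=
    ((M.measurable_f n θ).div (M.measurable_p n)).coe_nnreal_ennreal
  have := M.isProb_F θ
  have hproj : Measurable fun (x : ℕ → Ξ) (t : Fin n) => x t :=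
    measurable_pi_lambda _ fun t => measurable_pi_apply _
  have hone : ∫⁻ x, (M.f n θ x : ℝ≥0∞) ∂M.ν n = 1 := by
    have := congrArg (fun μ => μ Set.univ) (M.law_f n θ)
    simpa [Measure.map_apply hproj, withDensity_apply] using this.symm
  calc ∫⁻ ω, (M.R n θ ω : ℝ≥0∞) ∂M.P
      = ∫⁻ x, ((M.f n θ x / M.p n x : ℝ≥0) : ℝ≥0∞) ∂(M.P.map (M.data n)) :=
        (lintegral_map hg (M.measurable_data n)).symm
    _ = ∫⁻ x, (M.p n x : ℝ≥0∞) * ((M.f n θ x / M.p n x : ℝ≥0) : ℝ≥0∞) ∂M.ν n := by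
        rw [map_data, lintegral_withDensity_eq_lintegral_mul _
          (M.measurable_p n).coe_nnreal_ennreal hg]
        rfl
    _ ≤ ∫⁻ x, (M.f n θ x : ℝ≥0∞) ∂M.ν n := by
        refine lintegral_mono fun x => ?_
        rw [← ENNReal.coe_mul, ENNReal.coe_le_coe]
        rcases eq_or_ne (M.p n x) 0 with h0 | h0
        · simp [h0]
        · rw [mul_div_cancel₀ _ h0]
    _ = 1 := hone

/-- The probability of the data cancels in Bayes' formula. -/
lemma posterior_eq_lintegral_R (M : BayesModel Ω Ξ T) {n : ℕ} {ω : Ω}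
    (hp : M.p n (M.data n ω) ≠ 0) (A : Set T) :
    M.posterior n (M.data n ω) A =
      ((∫⁻ θ in A, (M.R n θ ω : ℝ≥0∞) ∂M.prior) / ∫⁻ θ, (M.R n θ ω : ℝ≥0∞) ∂M.prior).toReal := by
  have hf : ∀ θ, (M.f n θ (M.data n ω) : ℝ≥0∞)
      = (M.p n (M.data n ω) : ℝ≥0∞) * (M.R n θ ω : ℝ≥0∞) := by
    intro θ
    rw [← ENNReal.coe_mul, R, mul_div_cancel₀ _ hp]
  simp only [posterior, hf]
  rw [lintegral_const_mul' _ _ ENNReal.coe_ne_top, lintegral_const_mul' _ _ ENNReal.coe_ne_top,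
    ENNReal.mul_div_mul_left _ _ (by exact_mod_cast hp) ENNReal.coe_ne_top]

lemma ShaliziConditions.measurable_R {M : BayesModel Ω Ξ T} (hM : M.ShaliziConditions) (n : ℕ) :
    Measurable fun q : Ω × T => (M.R n q.2 q.1 : ℝ≥0∞) := by
  refine ((hM.s1 n).mono ?_ le_rfl).coe_nnreal_ennreal
  exact sup_le_sup (MeasurableSpace.comap_mono (M.measurable_data n).comap_le) le_rfl

lemma ShaliziConditions.aemeasurable_posterior {M : BayesModel Ω Ξ T} (hM : M.ShaliziConditions)
    (n : ℕ) (A : Set T) : AEMeasurable (fun ω => M.posterior n (M.data n ω) A) M.P := by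
  have := M.isProb_prior
  refine ⟨fun ω => ((∫⁻ θ in A, (M.R n θ ω : ℝ≥0∞) ∂M.prior) /
    ∫⁻ θ, (M.R n θ ω : ℝ≥0∞) ∂M.prior).toReal, ?_, ?_⟩
  · exact ((hM.measurable_R n).lintegral_prod_right'.div
      (hM.measurable_R n).lintegral_prod_right').ennreal_toReal
  · filter_upwards [M.ae_p_ne_zero n] with ω hω
    exact M.posterior_eq_lintegral_R hω A

lemma posterior_nonneg (M : BayesModel Ω Ξ T) (n : ℕ) (x : Fin n → Ξ) (A : Set T) :
    0 ≤ M.posterior n x A := ENNReal.toReal_nonneg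

lemma lintegral_div_lintegral_le_one (M : BayesModel Ω Ξ T) (n : ℕ) (x : Fin n → Ξ) (A : Set T) :
    (∫⁻ θ in A, (M.f n θ x : ℝ≥0∞) ∂M.prior) / ∫⁻ θ, (M.f n θ x : ℝ≥0∞) ∂M.prior ≤ 1 :=
  ENNReal.div_le_of_le_mul (by rw [one_mul]; exact setLIntegral_le_lintegral _ _)

lemma posterior_le_one (M : BayesModel Ω Ξ T) (n : ℕ) (x : Fin n → Ξ) (A : Set T) :
    M.posterior n x A ≤ 1 :=
  ENNReal.toReal_le_of_le_ofReal zero_le_one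
    (by simpa using M.lintegral_div_lintegral_le_one n x A)

lemma posterior_mono (M : BayesModel Ω Ξ T) (n : ℕ) (x : Fin n → Ξ) {A B : Set T} (h : A ⊆ B) :
    M.posterior n x A ≤ M.posterior n x B :=
  ENNReal.toReal_mono ((M.lintegral_div_lintegral_le_one n x B).trans_lt ENNReal.one_lt_top).ne
    (ENNReal.div_le_div_right (lintegral_mono_set h) _)

/-! ### The divergence rate -/

lemma ShaliziConditions.hSet_univ_ne_top {M : BayesModel Ω Ξ T} (hM : M.ShaliziConditions) :
    M.hSet Set.univ ≠ ∞ := by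
  have := M.isProb_prior
  intro htop
  have hae : ∀ᵐ θ ∂M.prior, M.hSet Set.univ ≤ M.h θ := by
    simpa [hSet] using ae_essInf_le (μ := M.prior) (f := M.h)
  have hI : MeasurableSet M.infSet := hM.s3_measurable (measurableSet_singleton _)
  have : M.prior M.infSet = 1 := by
    rw [← prob_compl_eq_zero_iff hI]
    refine measure_mono_null ?_ hae
    intro θ hθ hle
    exact hθ (top_le_iff.1 (htop ▸ hle))
  exact hM.s4.ne this

/-- The parameters that come close to the smallest divergence rate have positive prior mass. -/
lemma ShaliziConditions.prior_h_lt_pos {M : BayesModel Ω Ξ T} (hM : M.ShaliziConditions)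
    {ε : ℝ≥0∞} (hε : ε ≠ 0) : M.prior {θ | M.h θ < M.hSet Set.univ + ε} ≠ 0 := by
  intro h0
  have hle : M.hSet Set.univ + ε ≤ M.hSet Set.univ := by
    conv_rhs => rw [hSet, Measure.restrict_univ]
    refine le_essInf_of_ae_le _ ?_
    filter_upwards [measure_eq_zero_iff_ae_notMem.1 h0] with θ hθ
    exact not_lt.1 hθ
  exact (ENNReal.lt_add_right hM.hSet_univ_ne_top hε).not_ge hle

lemma ShaliziConditions.JSet_univ {M : BayesModel Ω Ξ T} (hM : M.ShaliziConditions) :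
    M.JSet Set.univ = 0 := by
  by_contra hne
  refine hM.prior_h_lt_pos hne (measure_eq_zero_iff_ae_notMem.2 ?_)
  have hae : ∀ᵐ θ ∂M.prior, M.JSet Set.univ ≤ M.J θ := by
    simpa [JSet] using ae_essInf_le (μ := M.prior) (f := M.J)
  filter_upwards [hae] with θ hθ hlt
  rw [J] at hθ
  have hpos : 0 < M.h θ - M.hSet Set.univ := (pos_iff_ne_zero.2 hne).trans_le hθ
  exact (add_le_of_le_tsub_left_of_le (tsub_pos_iff_lt.1 hpos).le hθ).not_gt hlt

/-- If `J(A)` is not the minimal value, then the divergence rate on `A` exceeds its essential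
infimum by a positive real number, up to a null set. -/
lemma ShaliziConditions.exists_gap {M : BayesModel Ω Ξ T} (hM : M.ShaliziConditions) {A : Set T}
    (hA : MeasurableSet A) (hJ : M.JSet A ≠ M.JSet Set.univ) :
    ∃ e : ℝ, 0 < e ∧
      ∀ᵐ θ ∂M.prior, θ ∈ A → M.hSet Set.univ + ENNReal.ofReal e ≤ M.h θ := by
  rw [hM.JSet_univ] at hJ
  have hmin : min (M.JSet A) 1 ≠ ∞ := (min_le_right _ _).trans_lt ENNReal.one_lt_top |>.ne
  have hmin0 : 0 < min (M.JSet A) 1 := lt_min (pos_iff_ne_zero.2 hJ) one_pos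
  refine ⟨(min (M.JSet A) 1).toReal, ENNReal.toReal_pos hmin0.ne' hmin, ?_⟩
  rw [ENNReal.ofReal_toReal hmin, ← ae_restrict_iff' hA]
  filter_upwards [show ∀ᵐ θ ∂M.prior.restrict A, M.JSet A ≤ M.J θ from ae_essInf_le] with θ hθ
  have hle : min (M.JSet A) 1 ≤ M.h θ - M.hSet Set.univ := (min_le_left _ _).trans hθ
  have hpos : 0 < M.h θ - M.hSet Set.univ := hmin0.trans_le hle
  exact add_le_of_le_tsub_left_of_le (tsub_pos_iff_lt.1 hpos).le hle

/-! ### Convergence of the posterior -/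

/-- The part of the marginal likelihood outside the sieve is exponentially small: its expectation is
at most the prior mass of the complement of the sieve, and the sum over `n` of the expectations
remains finite after multiplication by `exp (n s)`. -/
lemma IsSieve.tendsto_lintegral_compl {M : BayesModel Ω Ξ T} (hM : M.ShaliziConditions)
    {G : ℕ → Set T} (hG : M.IsSieve G) {α ς s : ℝ} (hs : s < ς)
    (hprior : ∀ n : ℕ, 1 ≤ n → 1 - α * Real.exp (-ς * n) ≤ (M.prior (G n)).toReal) :
    ∀ᵐ ω ∂M.P, Tendsto (fun n : ℕ => ENNReal.ofReal (Real.exp (n * s)) *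
      ∫⁻ θ in (G n)ᶜ, (M.R n θ ω : ℝ≥0∞) ∂M.prior) atTop (𝓝 0) := by
  have := M.isProb_prior
  have := M.isProb_P
  have hmeas : ∀ n : ℕ, Measurable fun ω => ENNReal.ofReal (Real.exp (n * s)) *
      ∫⁻ θ in (G n)ᶜ, (M.R n θ ω : ℝ≥0∞) ∂M.prior := fun n =>
    (hM.measurable_R n).lintegral_prod_right'.const_mul _
  have hcompl : ∀ n : ℕ, 1 ≤ n → M.prior (G n)ᶜ ≤ ENNReal.ofReal (α * Real.exp (-ς * n)) := by
    intro n hn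
    rw [← ofReal_measureReal, probReal_compl_eq_one_sub (hG.measurable n)]
    refine ENNReal.ofReal_le_ofReal ?_
    have := hprior n hn
    rw [measureReal_def]
    linarith
  have hexp : ∀ n : ℕ, ∫⁻ ω, (ENNReal.ofReal (Real.exp (n * s)) *
      ∫⁻ θ in (G n)ᶜ, (M.R n θ ω : ℝ≥0∞) ∂M.prior) ∂M.P
        ≤ ENNReal.ofReal (Real.exp (n * s)) * M.prior (G n)ᶜ := by
    intro n
    rw [lintegral_const_mul _ (hM.measurable_R n).lintegral_prod_right',
      lintegral_lintegral_swap (hM.measurable_R n).aemeasurable]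
    gcongr
    calc ∫⁻ θ in (G n)ᶜ, ∫⁻ ω, (M.R n θ ω : ℝ≥0∞) ∂M.P ∂M.prior
        ≤ ∫⁻ _ in (G n)ᶜ, 1 ∂M.prior := lintegral_mono fun θ => M.lintegral_R_le_one n θ
      _ = M.prior (G n)ᶜ := by simp
  have hgeom : Summable fun n : ℕ => α * Real.exp (s - ς) ^ n :=
    (summable_geometric_of_lt_one (Real.exp_pos _).le
      (by simpa using hs)).mul_left α
  have hsum : ∑' n : ℕ, ∫⁻ ω, (ENNReal.ofReal (Real.exp ((n + 1 : ℕ) * s)) *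
      ∫⁻ θ in (G (n + 1))ᶜ, (M.R (n + 1) θ ω : ℝ≥0∞) ∂M.prior) ∂M.P ≠ ∞ := by
    have hfin := ((summable_nat_add_iff 1).2 hgeom).tsum_ofReal_ne_top
    refine ne_top_of_le_ne_top hfin (ENNReal.tsum_le_tsum fun n => (hexp (n + 1)).trans ?_)
    calc _ ≤ ENNReal.ofReal (Real.exp ((n + 1 : ℕ) * s)) *
          ENNReal.ofReal (α * Real.exp (-ς * (n + 1 : ℕ))) := by
            gcongr; exact hcompl _ (by omega)
      _ = ENNReal.ofReal (α * Real.exp (s - ς) ^ (n + 1)) := by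
            rw [← ENNReal.ofReal_mul (Real.exp_pos _).le, ← Real.exp_nat_mul, mul_left_comm,
              ← Real.exp_add]
            congr 3
            ring
  rw [← lintegral_tsum fun n => (hmeas (n + 1)).aemeasurable] at hsum
  filter_upwards [ae_lt_top (Measurable.tsum fun n => hmeas (n + 1)) hsum] with ω hω
  exact (tendsto_add_atTop_iff_nat 1).1 (ENNReal.tendsto_atTop_zero_of_tsum_ne_top hω.ne)

/-- Inside the sieve, the part of the marginal likelihood over a set on which the divergence rate
exceeds `h(Θ) + e` is eventually below `exp (-n (h(Θ) + e / 2))`. -/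
lemma IsSieve.eventually_lintegral_inter_le {M : BayesModel Ω Ξ T} (hM : M.ShaliziConditions)
    {G : ℕ → Set T} (hG : M.IsSieve G) {A : Set T} (hA : MeasurableSet A) {e : ℝ} (he : 0 < e)
    (hgap : ∀ᵐ θ ∂M.prior, θ ∈ A → M.hSet Set.univ + ENNReal.ofReal e ≤ M.h θ) :
    ∀ᵐ ω ∂M.P, ∀ᶠ n : ℕ in atTop, ∫⁻ θ in A ∩ G n, (M.R n θ ω : ℝ≥0∞) ∂M.prior ≤
      ENNReal.ofReal (Real.exp (n * -((M.hSet Set.univ).toReal + e / 2))) := by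
  have := M.isProb_prior
  set H := (M.hSet Set.univ).toReal with hH
  filter_upwards [hG.s5_uniform, hG.s5_uniform_inf] with ω h1 h2
  filter_upwards [h1 (e / 2) (by positivity), h2 (H + e / 2), eventually_gt_atTop 0]
    with n h1 h2 hn
  have hR : ∀ᵐ θ ∂M.prior, θ ∈ A ∩ G n → (M.R n θ ω : ℝ≥0∞) ≤
      ENNReal.ofReal (Real.exp (n * -(H + e / 2))) := by
    filter_upwards [hgap, h2] with θ hgap h2 hθ
    rw [← M.logR_le_coe_iff hn]
    by_cases hI : θ ∈ M.infSet
    · exact h2 ⟨hθ.2, hI⟩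
    · refine (h1 θ ⟨hθ.2, hI⟩).2.trans ?_
      have hle := ENNReal.toReal_mono hI (hgap hθ.1)
      rw [ENNReal.toReal_add hM.hSet_univ_ne_top ENNReal.ofReal_ne_top,
        ENNReal.toReal_ofReal he.le, ← hH] at hle
      rw [← ENNReal.ofReal_toReal (a := M.h θ) hI, EReal.coe_ennreal_ofReal,
        max_eq_left ENNReal.toReal_nonneg]
      norm_cast
      linarith
  calc ∫⁻ θ in A ∩ G n, (M.R n θ ω : ℝ≥0∞) ∂M.prior
      ≤ ∫⁻ _ in A ∩ G n, ENNReal.ofReal (Real.exp (n * -(H + e / 2))) ∂M.prior :=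
        setLIntegral_mono_ae' (hA.inter (hG.measurable n)) hR
    _ = ENNReal.ofReal (Real.exp (n * -(H + e / 2))) * M.prior (A ∩ G n) := by simp
    _ ≤ _ := mul_le_of_le_one_right' prob_le_one

/-- The marginal likelihood does not decay faster than at the rate `h(Θ)`: up to a constant it is at
least `exp (-n (h(Θ) + ε))`. The lower bound comes from the parameters in the sieve whose divergence
rate is below `h(Θ) + ε / 2`. -/
lemma IsSieve.exists_le_lintegral {M : BayesModel Ω Ξ T} (hM : M.ShaliziConditions)
    {G : ℕ → Set T} (hG : M.IsSieve G) {ε : ℝ} (hε : 0 < ε) :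
    ∃ c : ℝ≥0∞, c ≠ 0 ∧ c ≠ ∞ ∧ ∀ᵐ ω ∂M.P, ∀ᶠ n : ℕ in atTop,
      ENNReal.ofReal (Real.exp (n * -((M.hSet Set.univ).toReal + ε))) * c ≤
        ∫⁻ θ, (M.R n θ ω : ℝ≥0∞) ∂M.prior := by
  have := M.isProb_prior
  set H := (M.hSet Set.univ).toReal with hH
  set B := {θ | M.h θ < M.hSet Set.univ + ENNReal.ofReal (ε / 2)} with hB
  have hBm : MeasurableSet B := measurableSet_lt hM.s3_measurable measurable_const
  have hB0 : M.prior B ≠ 0 := hM.prior_h_lt_pos (ENNReal.ofReal_pos.2 (half_pos hε)).ne'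
  refine ⟨M.prior B / 2, (ENNReal.half_pos hB0).ne',
    (ENNReal.div_lt_top (measure_ne_top _ _) two_ne_zero).ne, ?_⟩
  have hlim : Tendsto (fun n => M.prior (G n ∩ B)) atTop (𝓝 (M.prior B)) := by
    refine tendsto_measure_of_tendsto_indicator_of_isFiniteMeasure atTop M.prior
      (fun n => (hG.measurable n).inter hBm) ?_
    intro θ
    filter_upwards [hG.tendsto_univ θ] with n hn
    simp [hn]
  have hhalf := hlim.eventually_const_lt (ENNReal.half_lt_self hB0 (measure_ne_top _ _))
  filter_upwards [hG.s5_uniform] with ω h1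
  filter_upwards [h1 (ε / 2) (by positivity), hhalf, eventually_gt_atTop 0] with n h1 hn' hn
  have hR : ∀ θ ∈ G n ∩ B, ENNReal.ofReal (Real.exp (n * -(H + ε))) ≤ (M.R n θ ω : ℝ≥0∞) := by
    intro θ hθ
    have hlt : M.h θ < M.hSet Set.univ + ENNReal.ofReal (ε / 2) := hθ.2
    have hfin : M.hSet Set.univ + ENNReal.ofReal (ε / 2) ≠ ∞ :=
      ENNReal.add_ne_top.2 ⟨hM.hSet_univ_ne_top, ENNReal.ofReal_ne_top⟩
    have hI : M.h θ ≠ ∞ := hlt.ne_top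
    rw [← M.coe_le_logR_iff hn]
    refine le_trans ?_ (h1 θ ⟨hθ.1, hI⟩).1
    have hle := ENNReal.toReal_mono hfin hlt.le
    rw [ENNReal.toReal_add hM.hSet_univ_ne_top ENNReal.ofReal_ne_top,
      ENNReal.toReal_ofReal (by positivity), ← hH] at hle
    rw [← ENNReal.ofReal_toReal hI, EReal.coe_ennreal_ofReal, max_eq_left ENNReal.toReal_nonneg]
    norm_cast
    linarith
  calc ENNReal.ofReal (Real.exp (n * -(H + ε))) * (M.prior B / 2)
      ≤ ENNReal.ofReal (Real.exp (n * -(H + ε))) * M.prior (G n ∩ B) := by gcongr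
    _ = ∫⁻ _ in G n ∩ B, ENNReal.ofReal (Real.exp (n * -(H + ε))) ∂M.prior := by simp
    _ ≤ ∫⁻ θ in G n ∩ B, (M.R n θ ω : ℝ≥0∞) ∂M.prior :=
        setLIntegral_mono' ((hG.measurable n).inter hBm) hR
    _ ≤ _ := setLIntegral_le_lintegral _ _

/-- The posterior probability of a set on which the divergence rate is bounded away from its
essential infimum tends to zero almost surely. -/
lemma ShaliziConditions.tendsto_posterior {M : BayesModel Ω Ξ T} (hM : M.ShaliziConditions)
    {A : Set T} (hA : MeasurableSet A) {e : ℝ} (he : 0 < e)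
    (hgap : ∀ᵐ θ ∂M.prior, θ ∈ A → M.hSet Set.univ + ENNReal.ofReal e ≤ M.h θ) :
    ∀ᵐ ω ∂M.P, Tendsto (fun n => M.posterior n (M.data n ω) A) atTop (𝓝 0) := by
  obtain ⟨G, hG⟩ := hM.sieve
  obtain ⟨α, -, ς, hς, hprior⟩ := hG.s5_prior
  set H := (M.hSet Set.univ).toReal with hH
  have hH0 : 0 ≤ H := ENNReal.toReal_nonneg
  have hςH : 2 * H < ς := by
    have h2 : (2 * M.hSet Set.univ).toReal < ς :=
      (ENNReal.lt_ofReal_iff_toReal_lt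
        (ENNReal.mul_ne_top ENNReal.ofNat_ne_top hM.hSet_univ_ne_top)).1 hς
    simpa using h2
  -- The numerator decays at the rates `H + e / 2` and `s`; both exceed the rate `H + ε` of the
  -- denominator.
  obtain ⟨s, hs1, hs2⟩ : ∃ s, H < s ∧ s < ς := exists_between (by linarith)
  obtain ⟨ε, hε, hεlt⟩ : ∃ ε, 0 < ε ∧ ε < min (e / 2) (s - H) :=
    exists_between (lt_min (by positivity) (by linarith))
  have hε1 : ε < e / 2 := hεlt.trans_le (min_le_left _ _)
  have hε2 : ε < s - H := hεlt.trans_le (min_le_right _ _)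
  obtain ⟨c, hc0, hctop, hden⟩ := hG.exists_le_lintegral hM hε
  filter_upwards [hG.tendsto_lintegral_compl hM hs2 hprior,
    hG.eventually_lintegral_inter_le hM hA he hgap, hden, ae_all_iff.2 M.ae_p_ne_zero]
    with ω hcompl hin hden hp
  have hdecay : Tendsto (fun n : ℕ => ENNReal.ofReal (Real.exp (n * (ε - e / 2)))) atTop (𝓝 0) := by
    have : Tendsto (fun n : ℕ => Real.exp (n * (ε - e / 2))) atTop (𝓝 0) :=
      Real.tendsto_exp_atBot.comp
        (tendsto_natCast_atTop_atTop.atTop_mul_const_of_neg (by linarith))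
    simpa using ENNReal.tendsto_ofReal this
  have hbound : Tendsto (fun n : ℕ => (ENNReal.ofReal (Real.exp (n * (ε - e / 2))) +
      ENNReal.ofReal (Real.exp (n * s)) * ∫⁻ θ in (G n)ᶜ, (M.R n θ ω : ℝ≥0∞) ∂M.prior) / c)
      atTop (𝓝 0) := by
    have := ENNReal.Tendsto.div_const (hdecay.add hcompl) (b := c) (Or.inr hc0)
    simpa using this
  have hratio : Tendsto (fun n : ℕ => (∫⁻ θ in A, (M.R n θ ω : ℝ≥0∞) ∂M.prior) /
      ∫⁻ θ, (M.R n θ ω : ℝ≥0∞) ∂M.prior) atTop (𝓝 0) := by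
    refine tendsto_of_tendsto_of_tendsto_of_le_of_le' tendsto_const_nhds hbound
      (Eventually.of_forall fun _ => zero_le) ?_
    filter_upwards [hin, hden] with n hin hden
    have hscale : ∀ r : ℝ, ENNReal.ofReal (Real.exp (n * r)) =
        ENNReal.ofReal (Real.exp (n * -(H + ε))) * ENNReal.ofReal (Real.exp (n * (r + H + ε))) := by
      intro r
      rw [← ENNReal.ofReal_mul (Real.exp_pos _).le, ← Real.exp_add]
      congr 2
      ring
    set E := ENNReal.ofReal (Real.exp (n * -(H + ε))) with hE
    have hE0 : E ≠ 0 := (ENNReal.ofReal_pos.2 (Real.exp_pos _)).ne'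
    have hEtop : E ≠ ∞ := ENNReal.ofReal_ne_top
    have hone : E * ENNReal.ofReal (Real.exp (n * s)) ≥ 1 := by
      rw [hE, ← ENNReal.ofReal_mul (Real.exp_pos _).le, ← Real.exp_add]
      rw [ge_iff_le, ENNReal.one_le_ofReal, Real.one_le_exp_iff]
      have : (0 : ℝ) ≤ n * (s - H - ε) := mul_nonneg n.cast_nonneg (by linarith)
      linarith
    have hnum : ∫⁻ θ in A, (M.R n θ ω : ℝ≥0∞) ∂M.prior ≤
        E * (ENNReal.ofReal (Real.exp (n * (ε - e / 2))) +
          ENNReal.ofReal (Real.exp (n * s)) * ∫⁻ θ in (G n)ᶜ, (M.R n θ ω : ℝ≥0∞) ∂M.prior) := by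
      calc ∫⁻ θ in A, (M.R n θ ω : ℝ≥0∞) ∂M.prior
          ≤ ∫⁻ θ in (A ∩ G n) ∪ (G n)ᶜ, (M.R n θ ω : ℝ≥0∞) ∂M.prior := by
            refine lintegral_mono_set fun θ hθ => ?_
            by_cases h : θ ∈ G n
            · exact Or.inl ⟨hθ, h⟩
            · exact Or.inr h
        _ ≤ ∫⁻ θ in A ∩ G n, (M.R n θ ω : ℝ≥0∞) ∂M.prior +
            ∫⁻ θ in (G n)ᶜ, (M.R n θ ω : ℝ≥0∞) ∂M.prior := lintegral_union_le _ _ _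
        _ ≤ _ := by
            rw [mul_add, ← mul_assoc]
            refine add_le_add (hin.trans_eq ?_) (le_mul_of_one_le_left' hone)
            rw [hscale]
            congr 3
            ring
    calc _ ≤ _ / (E * c) := ENNReal.div_le_div hnum hden
      _ = _ := ENNReal.mul_div_mul_left _ _ hE0 hEtop
  have := (ENNReal.tendsto_toReal ENNReal.zero_ne_top).comp hratio
  refine Tendsto.congr (fun n => ?_) this
  exact (M.posterior_eq_lintegral_R (hp n) A).symm

/-- The marginal likelihood ratio is almost surely finite, as its expectation is at most one. -/
lemma ShaliziConditions.ae_lintegral_R_lt_top {M : BayesModel Ω Ξ T} (hM : M.ShaliziConditions)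
    (n : ℕ) : ∀ᵐ ω ∂M.P, ∫⁻ θ, (M.R n θ ω : ℝ≥0∞) ∂M.prior < ∞ := by
  have := M.isProb_prior
  have := M.isProb_P
  refine ae_lt_top (hM.measurable_R n).lintegral_prod_right' ?_
  rw [lintegral_lintegral_swap (hM.measurable_R n).aemeasurable]
  refine ((lintegral_mono fun θ => M.lintegral_R_le_one n θ).trans_lt ?_).ne
  simp

/-- Almost surely, Bayes' formula eventually divides by a positive finite number, so that the
posterior probabilities of complementary sets add up to one. -/
lemma ShaliziConditions.eventually_posterior_compl {M : BayesModel Ω Ξ T}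
    (hM : M.ShaliziConditions) {A : Set T} (hA : MeasurableSet A) :
    ∀ᵐ ω ∂M.P, ∀ᶠ n in atTop,
      M.posterior n (M.data n ω) A + M.posterior n (M.data n ω) Aᶜ = 1 := by
  obtain ⟨G, hG⟩ := hM.sieve
  obtain ⟨c, hc0, -, hden⟩ := hG.exists_le_lintegral hM one_pos
  filter_upwards [hden, ae_all_iff.2 M.ae_p_ne_zero, ae_all_iff.2 hM.ae_lintegral_R_lt_top]
    with ω hden hp htop
  filter_upwards [hden] with n hden
  have hpos : ∫⁻ θ, (M.R n θ ω : ℝ≥0∞) ∂M.prior ≠ 0 := by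
    refine (lt_of_lt_of_le ?_ hden).ne'
    exact ENNReal.mul_pos (ENNReal.ofReal_pos.2 (Real.exp_pos _)).ne' hc0
  have hfin : ∀ B : Set T, (∫⁻ θ in B, (M.R n θ ω : ℝ≥0∞) ∂M.prior) /
      ∫⁻ θ, (M.R n θ ω : ℝ≥0∞) ∂M.prior ≠ ∞ := fun B =>
    ENNReal.div_ne_top ((setLIntegral_le_lintegral B _).trans_lt (htop n)).ne hpos
  rw [M.posterior_eq_lintegral_R (hp n), M.posterior_eq_lintegral_R (hp n),
    ← ENNReal.toReal_add (hfin _) (hfin _), ENNReal.div_add_div_same, lintegral_add_compl _ hA,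
    ENNReal.div_self hpos (htop n).ne, ENNReal.toReal_one]

end BayesModel

/-! ### Conditional expectations given events that almost surely occur eventually -/

section Cond

variable {Ω : Type*} [MeasurableSpace Ω] {P : Measure Ω} [IsProbabilityMeasure P] {S : ℕ → Set Ω}

lemma tendsto_measure_one_of_ae_eventually_mem (hS : ∀ n, MeasurableSet (S n))
    (hmem : ∀ᵐ ω ∂P, ∀ᶠ n in atTop, ω ∈ S n) : Tendsto (fun n => P (S n)) atTop (𝓝 1) := by
  rw [← measure_univ (μ := P)]
  refine tendsto_measure_of_ae_tendsto_indicator_of_isFiniteMeasure atTop MeasurableSet.univ hS ?_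
  filter_upwards [hmem] with ω hω
  filter_upwards [hω] with n hn
  simp [hn]

lemma tendsto_integral_cond_zero (hS : ∀ n, MeasurableSet (S n))
    (hmem : ∀ᵐ ω ∂P, ∀ᶠ n in atTop, ω ∈ S n) {g : ℕ → Ω → ℝ} {C : ℝ}
    (hg : ∀ n, AEStronglyMeasurable (g n) P) (hC : ∀ n ω, ‖g n ω‖ ≤ C)
    (hlim : ∀ᵐ ω ∂P, Tendsto (fun n => g n ω) atTop (𝓝 0)) :
    Tendsto (fun n => ∫ ω, g n ω ∂(ProbabilityTheory.cond P (S n))) atTop (𝓝 0) := by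
  have hone := tendsto_measure_one_of_ae_eventually_mem hS hmem
  have hinv : Tendsto (fun n => ((P (S n))⁻¹).toReal) atTop (𝓝 1) := by
    have := (ENNReal.tendsto_toReal (a := 1⁻¹) (by simp)).comp (tendsto_inv_iff.2 hone)
    simpa only [inv_one, ENNReal.toReal_one, Function.comp_def] using this
  have hint : Tendsto (fun n => ∫ ω, ‖g n ω‖ ∂P) atTop (𝓝 0) := by
    have := tendsto_integral_of_dominated_convergence (μ := P) (F := fun n ω => ‖g n ω‖)
      (f := fun _ => 0) (fun _ => C) (fun n => (hg n).norm) (integrable_const C)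
      (fun n => ae_of_all _ fun ω => by simpa using hC n ω)
      (hlim.mono fun ω hω => by simpa using hω.norm)
    simpa using this
  have hset : Tendsto (fun n => ∫ ω in S n, g n ω ∂P) atTop (𝓝 0) := by
    refine squeeze_zero_norm (fun n => ?_) hint
    have hi : Integrable (fun ω => ‖g n ω‖) P :=
      (Integrable.of_bound (hg n) C (ae_of_all _ (hC n))).norm
    exact (norm_integral_le_integral_norm _).trans
      (setIntegral_le_integral hi (ae_of_all _ fun ω => norm_nonneg _))
  simpa [ProbabilityTheory.cond, integral_smul_measure] using hinv.mul hset

end Cond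

/-! ### False discovery proportions -/

lemma ind_nonneg (b : Bool) : 0 ≤ ind b := by cases b <;> simp [ind]

lemma sum_mul_choiceProb {m n : ℕ} {Ξ : Type*} (D : (Fin n → Ξ) → Config m) (x : Fin n → Ξ)
    (a : Config m → ℝ) : ∑ d, a d * choiceProb D d x = a (D x) := by
  simp [choiceProb]

/-- The weighted proportion of discoveries is an average, so it is at most any common bound for the
weights of the discoveries. -/
lemma weighted_discovery_proportion_le {m : ℕ} (d : Config m) (r : Fin m → ℝ) {e : ℝ} (he : 0 ≤ e)
    (hr : ∀ i, d i = true → r i ≤ e) :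
    (∑ i, ind (d i) * r i) / max (∑ i, ind (d i)) 1 ≤ e := by
  rw [div_le_iff₀ (lt_max_of_lt_right one_pos)]
  calc ∑ i, ind (d i) * r i ≤ ∑ i, e * ind (d i) := by
        refine Finset.sum_le_sum fun i _ => ?_
        cases hd : d i
        · simp [ind]
        · simpa [ind] using hr i hd
    _ = e * ∑ i, ind (d i) := (Finset.mul_sum _ _ _).symm
    _ ≤ _ := mul_le_mul_of_nonneg_left (le_max_left _ _) he

lemma weighted_discovery_proportion_nonneg {m : ℕ} (d : Config m) (r : Fin m → ℝ)
    (hr : ∀ i, 0 ≤ r i) : 0 ≤ (∑ i, ind (d i) * r i) / max (∑ i, ind (d i)) 1 :=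
  div_nonneg (Finset.sum_nonneg fun i _ => mul_nonneg (ind_nonneg _) (hr i))
    (zero_le_one.trans (le_max_right _ _))

namespace TestingProblem

variable {m : ℕ} {ι Ω Ξ : Type*} {Θ : ι → Type*} [MeasurableSpace ((k : ι) → Θ k)]
  [MeasurableSpace Ω] [MeasurableSpace Ξ]

/-! ### The true configuration -/

lemma measurableSet_hyp (Q : TestingProblem m Θ) (b : Bool) (i : Fin m) :
    MeasurableSet (Q.hyp b i) := by
  cases b
  · simpa [hyp] using Q.measurable_null i
  · exact (Q.measurable_null i).compl

lemma measurableSet_cell (Q : TestingProblem m Θ) (d : Config m) : MeasurableSet (Q.cell d) := by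
  have : Q.cell d = ⋂ i, Q.hyp (d i) i := by ext; simp [cell]
  rw [this]
  exact MeasurableSet.iInter fun i => Q.measurableSet_hyp (d i) i

lemma exists_mem_cell (Q : TestingProblem m Θ) (θ : (k : ι) → Θ k) : ∃ d, θ ∈ Q.cell d := by
  classical
  refine ⟨fun i => decide (θ (Q.c i) ∉ Q.null i), fun i => ?_⟩
  by_cases h : θ (Q.c i) ∈ Q.null i <;> simp [hyp, h]

lemma hyp_true_subset_compl_cell (Q : TestingProblem m Θ) {d : Config m} {i : Fin m}
    (hi : d i = false) : Q.hyp true i ⊆ (Q.cell d)ᶜ := by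
  intro θ hθ hc
  have := hc i
  simp only [hyp, hi] at this hθ
  simp_all

/-- The complement of the true cell consists of finitely many cells, on each of which the divergence
rate is bounded away from its essential infimum. -/
lemma IsTrueConfig.tendsto_posterior_compl_cell {Q : TestingProblem m Θ}
    {M : BayesModel Ω Ξ ((k : ι) → Θ k)} {dt : Config m} (hdt : Q.IsTrueConfig M dt)
    (hM : M.ShaliziConditions) :
    ∀ᵐ ω ∂M.P, Tendsto (fun n => M.posterior n (M.data n ω) (Q.cell dt)ᶜ) atTop (𝓝 0) := by
  have hgap : ∀ d : Config m, ∃ e : ℝ, 0 < e ∧ (d ≠ dt → ∀ᵐ θ ∂M.prior, θ ∈ Q.cell d →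
      M.hSet Set.univ + ENNReal.ofReal e ≤ M.h θ) := by
    intro d
    by_cases hd : d = dt
    · exact ⟨1, one_pos, fun h => absurd hd h⟩
    · obtain ⟨e, he, h⟩ := hM.exists_gap (Q.measurableSet_cell d) (mt (hdt d).1 hd)
      exact ⟨e, he, fun _ => h⟩
  choose e he hgap using hgap
  obtain ⟨d₀, hd₀⟩ := Finite.exists_min e
  refine hM.tendsto_posterior (Q.measurableSet_cell dt).compl (he d₀) ?_
  have hall : ∀ᵐ θ ∂M.prior, ∀ d : Config m, d ≠ dt → θ ∈ Q.cell d →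
      M.hSet Set.univ + ENNReal.ofReal (e d) ≤ M.h θ :=
    ae_all_iff.2 fun d => by
      by_cases hd : d = dt
      · exact ae_of_all _ fun θ h => absurd hd h
      · filter_upwards [hgap d hd] with θ hθ _ using hθ
  filter_upwards [hall] with θ hθ hmem
  obtain ⟨d, hd⟩ := Q.exists_mem_cell θ
  have hne : d ≠ dt := fun h => hmem (h ▸ hd)
  refine le_trans ?_ (hθ d hne hd)
  gcongr
  exact hd₀ d

lemma posterior_cell_le_w (Q : TestingProblem m Θ) (M : BayesModel Ω Ξ ((k : ι) → Θ k)) (n : ℕ)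
    (x : Fin n → Ξ) {d : Config m} {i : Fin m} (hi : d i = true) :
    M.posterior n x (Q.cell d) ≤ Q.w M n x d i :=
  M.posterior_mono n x fun _ hθ => ⟨hi ▸ hθ i, fun j _ _ => hθ j⟩

lemma w_le_posterior_compl_cell (Q : TestingProblem m Θ) (M : BayesModel Ω Ξ ((k : ι) → Θ k))
    (n : ℕ) (x : Fin n → Ξ) {dt : Config m} (d : Config m) {i : Fin m} (hi : dt i = false) :
    Q.w M n x d i ≤ M.posterior n x (Q.cell dt)ᶜ :=
  M.posterior_mono n x fun _ hθ => Q.hyp_true_subset_compl_cell hi hθ.1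

/-- Each wrong decision costs at least `η`, up to errors in the posterior probabilities of total size
at most `m ε`. -/
lemma objective_lt_objective (Q : TestingProblem m Θ) (M : BayesModel Ω Ξ ((k : ι) → Θ k))
    {n : ℕ} {x : Fin n → Ξ} {dt d : Config m} {b ε η : ℝ} (hη1 : η ≤ b) (hη2 : η ≤ 1 - b)
    (hε : m * ε < η) (hcell : 1 - ε ≤ M.posterior n x (Q.cell dt))
    (hcompl : M.posterior n x (Q.cell dt)ᶜ ≤ ε) (hd : d ≠ dt) :
    Q.objective M b n x d < Q.objective M b n x dt := by
  have hε0 : 0 ≤ ε := (M.posterior_nonneg _ _ _).trans hcompl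
  obtain ⟨j, hj⟩ := Function.ne_iff.1 hd
  have hη0 : 0 < η := (by positivity : 0 ≤ m * ε).trans_lt hε
  have hterm : ∀ i, (if d i ≠ dt i then η else 0) - ε ≤
      ind (dt i) * (Q.w M n x dt i - b) - ind (d i) * (Q.w M n x d i - b) := by
    intro i
    have h1 : Q.w M n x d i ≤ 1 := M.posterior_le_one _ _ _
    have h2 : dt i = false → Q.w M n x d i ≤ ε := fun h =>
      (Q.w_le_posterior_compl_cell M n x d h).trans hcompl
    have h3 : dt i = true → 1 - ε ≤ Q.w M n x dt i := fun h =>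
      hcell.trans (Q.posterior_cell_le_w M n x h)
    cases ht : dt i <;> cases hdi : d i <;> simp [ind, ht] at h2 h3 ⊢ <;> linarith
  have hsum := Finset.sum_le_sum fun i (_ : i ∈ Finset.univ) => hterm i
  rw [Finset.sum_sub_distrib, Finset.sum_sub_distrib] at hsum
  have hsingle : η ≤ ∑ i, if d i ≠ dt i then η else 0 := by
    have := Finset.single_le_sum (f := fun i => if d i ≠ dt i then η else 0)
      (fun i _ => by split_ifs <;> linarith) (Finset.mem_univ j)
    simpa [hj] using this
  simp only [Finset.sum_const, Finset.card_univ, Fintype.card_fin, nsmul_eq_mul] at hsum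
  simp only [objective]
  linarith

lemma exists_pos_eventually_le {β : ℕ → ℝ} (hβ : ∀ n, 0 < β n ∧ β n < 1)
    (h0 : 0 < liminf β atTop) (h1 : limsup β atTop < 1) :
    ∃ η : ℝ, 0 < η ∧ ∀ᶠ n in atTop, η ≤ β n ∧ η ≤ 1 - β n := by
  have hbelow : IsBoundedUnder (· ≥ ·) atTop β := isBoundedUnder_of ⟨0, fun n => (hβ n).1.le⟩
  have habove : IsBoundedUnder (· ≤ ·) atTop β := isBoundedUnder_of ⟨1, fun n => (hβ n).2.le⟩
  obtain ⟨a, ha0, ha⟩ := exists_between h0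
  obtain ⟨b, hb, hb1⟩ := exists_between h1
  refine ⟨min a (1 - b), lt_min ha0 (by linarith), ?_⟩
  filter_upwards [eventually_lt_of_lt_liminf ha hbelow, eventually_lt_of_limsup_lt hb habove]
    with n hn1 hn2
  exact ⟨(min_le_left _ _).trans hn1.le, (min_le_right _ _).trans (by linarith)⟩

/-- The non-marginal procedure is consistent: almost surely it eventually chooses the true
configuration. -/
lemma IsNonMarginal.eventually_eq {Q : TestingProblem m Θ} {M : BayesModel Ω Ξ ((k : ι) → Θ k)}
    {β : ℕ → ℝ} {D : (n : ℕ) → (Fin n → Ξ) → Config m} (hD : Q.IsNonMarginal M β D)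
    (hM : M.ShaliziConditions) {dt : Config m} (hdt : Q.IsTrueConfig M dt)
    (hβ : ∀ n, 0 < β n ∧ β n < 1) (h0 : 0 < liminf β atTop) (h1 : limsup β atTop < 1) :
    ∀ᵐ ω ∂M.P, ∀ᶠ n in atTop, D n (M.data n ω) = dt := by
  obtain ⟨η, hη, hηβ⟩ := exists_pos_eventually_le hβ h0 h1
  set ε : ℝ := η / (m + 1) with hε
  have hε0 : 0 < ε := by positivity
  have hmε : m * ε < η := by
    have : ε * (m + 1) = η := div_mul_cancel₀ _ (by positivity)
    linarith
  filter_upwards [hdt.tendsto_posterior_compl_cell hM,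
    hM.eventually_posterior_compl (Q.measurableSet_cell dt), ae_all_iff.2 fun n => (hD n).2]
    with ω hlim hadd hmax
  filter_upwards [hlim.eventually_le_const hε0, hadd, hηβ] with n hn hadd hηβ
  by_contra hne
  exact (hmax n dt).not_gt (Q.objective_lt_objective M hηβ.1 hηβ.2 hmε (by linarith) hn hne)

/-! ### Limits of the Bayesian false discovery rates -/

lemma measurableSet_someRejection (M : BayesModel Ω Ξ ((k : ι) → Θ k)) {n : ℕ}
    {D : (Fin n → Ξ) → Config m} (hD : Measurable D) : MeasurableSet (M.someRejection D) := by
  have : M.someRejection D = (fun ω => D (M.data n ω)) ⁻¹' {fun _ => false}ᶜ := by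
    ext ω
    simp [BayesModel.someRejection, choiceProb]
  rw [this]
  exact (hD.comp (M.measurable_data n)) (measurableSet_singleton _).compl

lemma ae_eventually_mem_someRejection {M : BayesModel Ω Ξ ((k : ι) → Θ k)}
    {D : (n : ℕ) → (Fin n → Ξ) → Config m} {dt : Config m} (hne : dt ≠ fun _ => false)
    (hD : ∀ᵐ ω ∂M.P, ∀ᶠ n in atTop, D n (M.data n ω) = dt) :
    ∀ᵐ ω ∂M.P, ∀ᶠ n in atTop, ω ∈ M.someRejection (D n) := by
  filter_upwards [hD] with ω hω
  filter_upwards [hω] with n hn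
  simp [BayesModel.someRejection, choiceProb, hn, hne]

/-- The limit of a Bayesian false discovery rate that weighs the decisions in `d` by the posterior
probabilities of sets `A d i`, where `A dt i` contains the true cell whenever `dt` rejects the `i`-th
null hypothesis. Both versions of the rate are of this form. -/
lemma tendsto_integral_cond_discovery_proportion (Q : TestingProblem m Θ)
    {M : BayesModel Ω Ξ ((k : ι) → Θ k)} (hM : M.ShaliziConditions) {dt : Config m}
    (hdt : Q.IsTrueConfig M dt) (hne : dt ≠ fun _ => false)
    {D : (n : ℕ) → (Fin n → Ξ) → Config m} (hDm : ∀ n, Measurable (D n))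
    (hD : ∀ᵐ ω ∂M.P, ∀ᶠ n in atTop, D n (M.data n ω) = dt)
    (A : Config m → Fin m → Set ((k : ι) → Θ k))
    (hA : ∀ i, dt i = true → Q.cell dt ⊆ A dt i) :
    Tendsto (fun n => ∫ ω, ∑ d : Config m,
      (∑ i, ind (d i) * (1 - M.posterior n (M.data n ω) (A d i))) / max (∑ i, ind (d i)) 1 *
        choiceProb (D n) d (M.data n ω) ∂(ProbabilityTheory.cond M.P (M.someRejection (D n))))
      atTop (𝓝 0) := by
  have := M.isProb_P
  have hnonneg : ∀ n ω (d : Config m),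
      0 ≤ (∑ i, ind (d i) * (1 - M.posterior n (M.data n ω) (A d i))) /
        max (∑ i, ind (d i)) 1 := fun n ω d =>
    weighted_discovery_proportion_nonneg d _ fun i => sub_nonneg.2 (M.posterior_le_one _ _ _)
  refine tendsto_integral_cond_zero (C := 1) (fun n => measurableSet_someRejection M (hDm n))
    (ae_eventually_mem_someRejection hne hD) (fun n => ?_) (fun n ω => ?_) ?_
  · refine AEMeasurable.aestronglyMeasurable ?_
    refine Finset.aemeasurable_fun_sum _ fun d _ => AEMeasurable.mul ?_ ?_
    · refine AEMeasurable.div_const (Finset.aemeasurable_fun_sum _ fun i _ => ?_) _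
      exact ((hM.aemeasurable_posterior n (A d i)).const_sub 1).const_mul _
    · refine (Measurable.ite ?_ measurable_const measurable_const).aemeasurable
      exact (hDm n).comp (M.measurable_data n) (measurableSet_singleton d)
  · rw [sum_mul_choiceProb, Real.norm_of_nonneg (hnonneg _ _ _)]
    refine weighted_discovery_proportion_le _ _ zero_le_one fun i _ => ?_
    linarith [M.posterior_nonneg n (M.data n ω) (A (D n (M.data n ω)) i)]
  · filter_upwards [hD, hdt.tendsto_posterior_compl_cell hM,
      hM.eventually_posterior_compl (Q.measurableSet_cell dt)] with ω hD hlim hadd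
    simp only [sum_mul_choiceProb]
    refine tendsto_of_tendsto_of_tendsto_of_le_of_le' tendsto_const_nhds hlim
      (Eventually.of_forall fun n => hnonneg _ _ _) ?_
    filter_upwards [hD, hadd] with n hD hadd
    rw [hD]
    refine weighted_discovery_proportion_le _ _ (M.posterior_nonneg _ _ _) fun i hi => ?_
    linarith [M.posterior_mono n (M.data n ω) (hA i hi)]

end TestingProblem

theorem mainTheorem3 {m : ℕ} {ι Ω Ξ : Type*} {Θ : ι → Type*} [MeasurableSpace ((k : ι) → Θ k)]
    [MeasurableSpace Ω] [MeasurableSpace Ξ]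
    (M : BayesModel Ω Ξ ((k : ι) → Θ k)) (hM : M.ShaliziConditions)
    (Q : TestingProblem m Θ)
    (dt : Config m) (hdt : Q.IsTrueConfig M dt)
    (β : ℕ → ℝ) (hβ : ∀ n, 0 < β n ∧ β n < 1)
    (hA1_lower : 0 < liminf β atTop) (hA1_upper : limsup β atTop < 1)
    (hA2_zero : dt ≠ fun _ => false) (hA2_one : dt ≠ fun _ => true)
    (D : (n : ℕ) → (Fin n → Ξ) → Config m) (hD : Q.IsNonMarginal M β D) :
    (∀ᶠ n in atTop, 0 < M.P (M.someRejection (D n))) ∧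
      Tendsto (fun n => Q.mpBFDR M (D n)) atTop (𝓝 0) ∧
      Tendsto (fun n => Q.pBFDR M (D n)) atTop (𝓝 0) := by
  have := M.isProb_P
  have hev := hD.eventually_eq hM hdt hβ hA1_lower hA1_upper
  refine ⟨?_, ?_, ?_⟩
  · exact (tendsto_measure_one_of_ae_eventually_mem
      (fun n => TestingProblem.measurableSet_someRejection M (hD n).1)
      (TestingProblem.ae_eventually_mem_someRejection hA2_zero hev)).eventually_const_lt one_pos
  · exact Q.tendsto_integral_cond_discovery_proportion hM hdt hA2_zero (fun n => (hD n).1) hev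
      (fun d i => {θ | θ ∈ Q.hyp true i ∧ ∀ j ∈ Q.group i, j ≠ i → θ ∈ Q.hyp (d j) j})
      fun i hi θ hθ => ⟨hi ▸ hθ i, fun j _ _ => hθ j⟩
  · exact Q.tendsto_integral_cond_discovery_proportion hM hdt hA2_zero (fun n => (hD n).1) hev
      (fun _ i => Q.hyp true i) fun i hi θ hθ => hi ▸ hθ i
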